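/- Let $G$ be a finite simple connected graph (no loops, no parallel edges) that is cubic (every vertex has degree $3$) and bridgeless, and let $t$ be a positive integer. A minimal cut of $G$ is an inclusion-wise minimal set $C\subseteq E(G)$ such that $G\setminus C$ (the graph obtained by deleting the edges of $C$) has more connected components than $G$; a $k$-cut is a minimal cut with exactly $k$ edges. Then there exist $t$ perfect matchings $M_1,\dots,M_t$ of $G$, not necessarily distinct, such that no $(2t+1)$-cut $C$ of $G$ satisfies $C\subseteq M_1\cap\dots\cap M_t$ (each $M_i$ being regarded as a set of edges). -/

import Mathlib

namespace SimpleGraph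

/-- A graph is bridgeless if none of its edges is a bridge. -/
def Bridgeless {V : Type*} (G : SimpleGraph V) : Prop :=
  ∀ e ∈ G.edgeSet, ¬ G.IsBridge e

/-- A set `C` of edges of `G` is separating if `G ∖ C` has more connected components than `G`.
(Only used for graphs on a finite vertex set, where the two cardinalities are honest.) -/
def IsSeparatingEdgeSet {V : Type*} (G : SimpleGraph V) (C : Set (Sym2 V)) : Prop :=
  C ⊆ G.edgeSet ∧
    Nat.card G.ConnectedComponent < Nat.card (G.deleteEdges C).ConnectedComponent

/-- A minimal cut of `G`: an inclusion-wise minimal separating set of edges. -/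
def IsMinimalCut {V : Type*} (G : SimpleGraph V) (C : Set (Sym2 V)) : Prop :=
  Minimal G.IsSeparatingEdgeSet C

/-- A `k`-cut of `G`: a minimal cut with exactly `k` edges. -/
def IsKCut {V : Type*} (G : SimpleGraph V) (k : ℕ) (C : Set (Sym2 V)) : Prop :=
  G.IsMinimalCut C ∧ C.ncard = k

end SimpleGraph

-- Let `A` be the 0/1 adjacency weight, let `m i` be the indicators of `t` perfect matchings, and
-- put `w = (t + 1) A - ∑ m i`. Every vertex has `w`-degree `3(t + 1) - t = 2t + 3`. It suffices to
-- choose the matchings so that every odd cut also has `w`-weight at least `2t + 3`: a `(2t +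
-- 1)`-cut inside all of them would be the boundary of a set, odd by parity, and each of its edges
-- would have `w`-weight `(t + 1) - t = 1`, giving total weight only `2t + 1`.
--
-- The matchings are found one at a time (`IsRGraph.exists_matchingWeights`). The next one, `m'`,
-- lies in the support of the current `w` and meets every tight odd cut (weight exactly `2t + 3`)
-- once. Passing to `w + A - m'` adds at least `3 - 1 = 2` to a tight cut, since bridgelessness
-- makes all odd cuts of `A` have weight at least `3`; a non-tight odd cut already has weight at
-- least `2t + 5` by parity, and loses nothing because `m' ≤ A`.
--
-- Such an `m'` exists (`IsRGraph.exists_isMatchingWeight_tight`) by induction on the number of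
-- vertices: contract either side of a nontrivial tight cut, glue the two matchings along a common
-- edge, and treat tight cuts that cross it by uncrossing. Without nontrivial tight cuts any perfect
-- matching works, and Tutte's theorem provides one.

universe u

/-! ### Weighted cuts, uncrossing and parity -/

section CutWeights

open scoped Classical

/-- The total weight of the ordered pairs leaving the vertex set `Y`. -/
noncomputable def cutWeight {V : Type*} [Fintype V] (w : V → V → ℕ) (Y : Set V) : ℕ :=
  ∑ u, ∑ v, if u ∈ Y ∧ v ∉ Y then w u v else 0

/-- The total weight of the ordered pairs from `A \ B` to `B \ A`. -/
noncomputable def crossWeight {V : Type*} [Fintype V] (w : V → V → ℕ) (A B : Set V) : ℕ :=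
  ∑ u, ∑ v, if (u ∈ A ∧ u ∉ B) ∧ (v ∈ B ∧ v ∉ A) then w u v else 0

/-- A weighted form of an `r`-graph: every vertex has weighted degree `r`, and every odd cut has
weight at least `r`. -/
structure IsRGraph {V : Type*} [Fintype V] (w : V → V → ℕ) (r : ℕ) : Prop where
  symm : ∀ u v, w u v = w v u
  diag : ∀ v, w v v = 0
  regular : ∀ v, cutWeight w {v} = r
  odd_cut : ∀ Y : Set V, Odd Y.ncard → r ≤ cutWeight w Y

/-- The indicator function of a perfect matching contained in the support of `w`. -/
structure IsMatchingWeight {V : Type*} [Fintype V] (w m : V → V → ℕ) : Prop where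
  symm : ∀ u v, m u v = m v u
  support : ∀ u v, m u v ≠ 0 → w u v ≠ 0
  regular : ∀ v, cutWeight m {v} = 1

variable {V W : Type*} [Fintype V]

theorem cutWeight_add (w m : V → V → ℕ) (Y : Set V) :
    cutWeight (fun u v => w u v + m u v) Y = cutWeight w Y + cutWeight m Y := by
  simp only [cutWeight, ← Finset.sum_add_distrib]
  refine Finset.sum_congr rfl fun u _ => Finset.sum_congr rfl fun v _ => ?_
  split_ifs <;> rfl

theorem cutWeight_compl {w : V → V → ℕ} (hw : ∀ u v, w u v = w v u) (Y : Set V) :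
    cutWeight w Yᶜ = cutWeight w Y := by
  unfold cutWeight
  rw [Finset.sum_comm]
  refine Finset.sum_congr rfl fun u _ => Finset.sum_congr rfl fun v _ => ?_
  simp [hw u v, and_comm]

theorem cutWeight_mono {w m : V → V → ℕ} (h : ∀ u v, m u v ≤ w u v) (Y : Set V) :
    cutWeight m Y ≤ cutWeight w Y := by
  unfold cutWeight
  gcongr with u _ v _
  split_ifs
  · exact h u v
  · rfl

theorem cutWeight_univ (w : V → V → ℕ) : cutWeight w Set.univ = 0 := by
  simp [cutWeight]

theorem cutWeight_singleton {w : V → V → ℕ} {a : V} (hw : w a a = 0) :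
    cutWeight w {a} = ∑ v, w a v := by
  unfold cutWeight
  rw [Finset.sum_eq_single a]
  · refine Finset.sum_congr rfl fun v _ => ?_
    by_cases h : v = a <;> simp [h, hw]
  · intro b _ hb
    simp [hb]
  · simp

theorem crossWeight_comm {w : V → V → ℕ} (hw : ∀ u v, w u v = w v u) (A B : Set V) :
    crossWeight w B A = crossWeight w A B := by
  unfold crossWeight
  rw [Finset.sum_comm]
  refine Finset.sum_congr rfl fun u _ => Finset.sum_congr rfl fun v _ => ?_
  simp [hw u v, and_comm]

/-- Submodularity with its exact error term. The equality matters: when it forces the cross weight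
of `w` to vanish, it becomes an additive identity for any matching in the support. -/
theorem cutWeight_uncross {w : V → V → ℕ} (hw : ∀ u v, w u v = w v u) (A B : Set V) :
    cutWeight w A + cutWeight w B =
      cutWeight w (A ∩ B) + cutWeight w (A ∪ B) + 2 * crossWeight w A B := by
  rw [two_mul]
  nth_rw 1 [← crossWeight_comm hw]
  simp only [cutWeight, crossWeight, ← Finset.sum_add_distrib]
  refine Finset.sum_congr rfl fun u _ => Finset.sum_congr rfl fun v _ => ?_
  by_cases h1 : u ∈ A <;> by_cases h2 : v ∈ A <;> by_cases h3 : u ∈ B <;> by_cases h4 : v ∈ B <;>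
    simp [h1, h2, h3, h4]

theorem crossWeight_eq_zero_of_support {w m : V → V → ℕ} (h : ∀ u v, m u v ≠ 0 → w u v ≠ 0)
    {A B : Set V} (hw : crossWeight w A B = 0) : crossWeight m A B = 0 := by
  simp only [crossWeight, Finset.sum_eq_zero_iff, Finset.mem_univ, true_implies] at hw ⊢
  intro u v
  have := hw u v
  have h' := h u v
  split_ifs with hc
  · rw [if_pos hc] at this
    by_contra h0
    exact h' h0 this
  · rfl

/-- Adding one vertex at a time, the uncrossing error is even. -/
theorem cutWeight_modEq {w : V → V → ℕ} {r : ℕ} (hw : ∀ u v, w u v = w v u)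
    (hr : ∀ v, cutWeight w {v} = r) (Y : Set V) : cutWeight w Y ≡ r * Y.ncard [MOD 2] := by
  induction Y, Y.toFinite using Set.Finite.induction_on with
  | empty => simp [cutWeight]; rfl
  | @insert a s ha hs ih =>
    have := cutWeight_uncross hw {a} s
    have he : ({a} ∩ s : Set V) = ∅ := by simpa using ha
    have h0 : cutWeight w ∅ = 0 := by simp [cutWeight]
    rw [he, h0, hr, Set.singleton_union] at this
    rw [Set.ncard_insert_of_notMem ha hs, mul_add]
    unfold Nat.ModEq at *
    omega

namespace IsRGraph

variable {w : V → V → ℕ} {r : ℕ}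

theorem even_card (h : IsRGraph w r) (hr : 0 < r) : Even (Nat.card V) := by
  by_contra hc
  have := h.odd_cut Set.univ (by rw [Set.ncard_univ]; exact Nat.not_even_iff_odd.1 hc)
  rw [cutWeight_univ] at this
  omega

theorem odd_compl (h : IsRGraph w r) (hr : 0 < r) {Y : Set V} (hY : Odd Y.ncard) :
    Odd Yᶜ.ncard := by
  have := Set.ncard_add_ncard_compl Y
  have := h.even_card hr
  grind

end IsRGraph

/-! ### Contraction of an odd set -/

/-- The weights induced on the codomain of `q` by identifying the vertices in each fibre. -/
noncomputable def contractWeight (q : V → W) (w : V → V → ℕ) (a b : W) : ℕ :=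
  if a = b then 0 else ∑ u, ∑ v, if q u = a ∧ q v = b then w u v else 0

theorem cutWeight_contractWeight [Fintype W] (q : V → W) (w : V → V → ℕ) (Y : Set W) :
    cutWeight (contractWeight q w) Y = cutWeight w (q ⁻¹' Y) := by
  have h1 : ∀ a b : W, (if a ∈ Y ∧ b ∉ Y then contractWeight q w a b else 0) =
      ∑ u, ∑ v, if q u = a then (if q v = b then (if a ∈ Y ∧ b ∉ Y then w u v else 0) else 0)
        else 0 := by
    intro a b
    by_cases h : a ∈ Y ∧ b ∉ Y
    · have hab : a ≠ b := fun hab => h.2 (hab ▸ h.1)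
      simp only [contractWeight, if_pos h, if_neg hab, ite_and]
    · simp [h]
  simp only [cutWeight, h1]
  have h2 : ∀ a : W, (∑ b, ∑ u, ∑ v, if q u = a then (if q v = b then
      (if a ∈ Y ∧ b ∉ Y then w u v else 0) else 0) else 0) =
      ∑ u, ∑ v, if q u = a then (if a ∈ Y ∧ q v ∉ Y then w u v else 0) else 0 := by
    intro a
    rw [Finset.sum_comm]
    refine Finset.sum_congr rfl fun u _ => ?_
    rw [Finset.sum_comm]
    refine Finset.sum_congr rfl fun v _ => ?_
    by_cases h : q u = a <;> simp [h]
  simp only [h2]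
  rw [Finset.sum_comm]
  refine Finset.sum_congr rfl fun u _ => ?_
  rw [Finset.sum_comm]
  refine Finset.sum_congr rfl fun v _ => ?_
  simp

theorem contractWeight_symm (q : V → W) {w : V → V → ℕ} (hw : ∀ u v, w u v = w v u) (a b : W) :
    contractWeight q w a b = contractWeight q w b a := by
  unfold contractWeight
  rw [Finset.sum_comm]
  simp only [eq_comm (a := a) (b := b), and_comm, hw]

theorem le_contractWeight (q : V → W) (w : V → V → ℕ) {u v : V} (h : q u ≠ q v) :
    w u v ≤ contractWeight q w (q u) (q v) := by
  rw [contractWeight, if_neg h]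
  calc w u v = if q u = q u ∧ q v = q v then w u v else 0 := by simp
    _ ≤ ∑ v', if q u = q u ∧ q v' = q v then w u v' else 0 :=
      Finset.single_le_sum (f := fun v' => if q u = q u ∧ q v' = q v then w u v' else 0)
        (fun _ _ => Nat.zero_le _) (Finset.mem_univ v)
    _ ≤ _ := Finset.single_le_sum
        (f := fun u' => ∑ v', if q u' = q u ∧ q v' = q v then w u' v' else 0)
        (fun _ _ => Nat.zero_le _) (Finset.mem_univ u)

theorem odd_ncard_preimage [Fintype W] (q : V → W) (hq : ∀ b, Odd (q ⁻¹' {b}).ncard) (Y : Set W) :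
    Odd (q ⁻¹' Y).ncard ↔ Odd Y.ncard := by
  have h : (q ⁻¹' Y).ncard = ∑ b ∈ Y.toFinset, (q ⁻¹' {b}).ncard := by
    simp only [Set.ncard_eq_toFinset_card']
    rw [Finset.card_eq_sum_card_fiberwise (f := q) (t := Y.toFinset) (by intro x; simp)]
    refine Finset.sum_congr rfl fun b hb => congrArg Finset.card ?_
    ext x
    simp only [Finset.mem_filter, Set.mem_toFinset, Set.mem_preimage, Set.mem_singleton_iff]
    exact ⟨fun h => h.2, fun h => ⟨by simpa [h] using hb, h⟩⟩
  rw [h, Finset.odd_sum_iff_odd_card_odd, Finset.filter_true_of_mem fun b _ => hq b,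
    Set.ncard_eq_toFinset_card']

/-- The map that collapses `X` to the single point `none`. -/
noncomputable def contractMap {V : Type*} (X : Set V) (v : V) : Option {v // v ∉ X} :=
  if h : v ∈ X then none else some ⟨v, h⟩

section ContractMap

variable {X : Set V}

@[simp] theorem contractMap_of_mem {V : Type*} {X : Set V} {v : V} (h : v ∈ X) :
    contractMap X v = none := dif_pos h

@[simp] theorem contractMap_of_notMem {V : Type*} {X : Set V} {v : V} (h : v ∉ X) :
    contractMap X v = some ⟨v, h⟩ := dif_neg h

@[simp] theorem contractMap_eq_none {V : Type*} {X : Set V} {v : V} :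
    contractMap X v = none ↔ v ∈ X := by
  by_cases h : v ∈ X <;> simp [h]

@[simp] theorem contractMap_eq_some {V : Type*} {X : Set V} {v : V} {x : {v // v ∉ X}} :
    contractMap X v = some x ↔ v = x := by
  by_cases h : v ∈ X
  · simp only [contractMap_of_mem h, reduceCtorEq, false_iff]
    rintro rfl
    exact x.2 h
  · simp [h, Subtype.ext_iff]

theorem contractMap_preimage_none {V : Type*} {X : Set V} : contractMap X ⁻¹' {none} = X := by
  ext v; simp

theorem contractMap_preimage_some {V : Type*} {X : Set V} (x : {v // v ∉ X}) :
    contractMap X ⁻¹' {some x} = {x.1} := by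
  ext v; simp

theorem odd_ncard_contractMap_preimage (hX : Odd X.ncard) (Y : Set (Option {v // v ∉ X})) :
    Odd (contractMap X ⁻¹' Y).ncard ↔ Odd Y.ncard := by
  refine odd_ncard_preimage _ (fun b => ?_) Y
  cases b with
  | none => rwa [contractMap_preimage_none]
  | some x => simp [contractMap_preimage_some]

theorem exists_contractMap_preimage_eq {V : Type*} {X Z : Set V} (h : X ⊆ Z ∨ Disjoint X Z) :
    ∃ Y, contractMap X ⁻¹' Y = Z := by
  refine ⟨contractMap X '' Z, Set.Subset.antisymm ?_ (Set.subset_preimage_image _ _)⟩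
  rintro v ⟨z, hz, hzv⟩
  by_cases hv : v ∈ X
  · rw [contractMap_of_mem hv, contractMap_eq_none] at hzv
    exact h.elim (fun h => h hv) fun h => (Set.disjoint_left.1 h hzv hz).elim
  · rw [contractMap_of_notMem hv, contractMap_eq_some] at hzv
    exact (show z = v from hzv) ▸ hz

theorem card_contractMap_lt (hX : 2 ≤ X.ncard) :
    Fintype.card (Option {v // v ∉ X}) < Fintype.card V := by
  have h1 : Fintype.card {v // v ∉ X} = Xᶜ.ncard := by
    rw [Set.ncard_eq_toFinset_card', Set.toFinset_card]
    exact Fintype.card_congr (Equiv.refl _)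
  have := Set.ncard_add_ncard_compl X
  rw [Nat.card_eq_fintype_card] at this
  rw [Fintype.card_option, h1]
  omega

/-- Cuts of the contraction are the cuts of `w` that do not split `X`; parity survives because `X`
is odd, and tightness of `X` gives the new vertex degree `r`. -/
theorem IsRGraph.contract {w : V → V → ℕ} {r : ℕ} (h : IsRGraph w r) (hX : Odd X.ncard)
    (hXr : cutWeight w X = r) : IsRGraph (contractWeight (contractMap X) w) r where
  symm := contractWeight_symm _ h.symm
  diag v := by simp [contractWeight]
  regular v := by
    rw [cutWeight_contractWeight]
    cases v with
    | none => rwa [contractMap_preimage_none]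
    | some x => rw [contractMap_preimage_some, h.regular]
  odd_cut Y hY := by
    rw [cutWeight_contractWeight]
    exact h.odd_cut _ ((odd_ncard_contractMap_preimage hX Y).2 hY)

end ContractMap

end CutWeights

/-! ### A perfect matching through a prescribed edge -/

section MatchingWeights

open scoped Classical

variable {V : Type u} [Fintype V] {w : V → V → ℕ} {r : ℕ}

theorem isMatchingWeight_of_existsUnique (hdiag : ∀ v, w v v = 0) {P : V → V → Prop}
    (hsymm : ∀ u v, P u v → P v u) (hsupp : ∀ u v, P u v → w u v ≠ 0)
    (hP : ∀ u, ∃! v, P u v) : IsMatchingWeight w fun u v => if P u v then 1 else 0 where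
  symm u v := by simp only [show P u v ↔ P v u from ⟨hsymm _ _, hsymm _ _⟩]
  support u v h := hsupp u v (by by_contra h'; simp [h'] at h)
  regular v := by
    rw [cutWeight_singleton (by simp only [ite_eq_right_iff]; exact fun h => (hsupp v v h (hdiag v)).elim)]
    obtain ⟨a, ha, hu⟩ := hP v
    rw [Finset.sum_eq_single a (fun b _ hb => if_neg fun h => hb (hu b h)) (by simp)]
    exact if_pos ha

/-- Each odd set sends weight at least `r` into `T`, which can absorb at most `r * T.ncard`; the
edge `xy` inside `T` makes the bound strict. -/
theorem IsRGraph.card_lt_ncard (h : IsRGraph w r) {T : Set V} {x y : V} (hx : x ∈ T) (hy : y ∈ T)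
    (hxy : w x y ≠ 0) {ι : Type*} [Fintype ι] (C : ι → Set V) (hodd : ∀ i, Odd (C i).ncard)
    (hdisj : ∀ i j u, u ∈ C i → u ∈ C j → i = j) (hCT : ∀ i, ∀ u ∈ C i, u ∉ T)
    (hadj : ∀ i, ∀ u ∈ C i, ∀ v, v ∉ C i → w u v ≠ 0 → v ∈ T) :
    Fintype.card ι < T.ncard := by
  have h1 : Fintype.card ι * r ≤ ∑ u, ∑ v, if u ∉ T ∧ v ∈ T then w u v else 0 := by
    calc Fintype.card ι * r = ∑ _i : ι, r := by simp
      _ ≤ ∑ i : ι, ∑ u, ∑ v, (if u ∈ C i then if v ∈ T then w u v else 0 else 0) := by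
        refine Finset.sum_le_sum fun i _ => (h.odd_cut _ (hodd i)).trans ?_
        unfold cutWeight
        gcongr with u _ v _
        by_cases hu : u ∈ C i
        · by_cases hv : v ∈ C i
          · simp [hv]
          · by_cases hw : w u v = 0
            · simp [hw]
            · simp [hu, hv, hadj i u hu v hv hw]
        · simp [hu]
      _ = ∑ u, ∑ v, ∑ i : ι, (if u ∈ C i then if v ∈ T then w u v else 0 else 0) := by
        rw [Finset.sum_comm]
        exact Finset.sum_congr rfl fun u _ => Finset.sum_comm
      _ ≤ _ := by
        gcongr with u _ v _
        by_cases hu : ∃ i, u ∈ C i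
        · obtain ⟨i, hi⟩ := hu
          rw [Finset.sum_eq_single i (fun j _ hj => if_neg fun hj' => hj (hdisj j i u hj' hi))
            (by simp)]
          simp [hi, hCT i u hi]
        · push Not at hu
          simp [hu]
  have h2 : ∑ u, ∑ v, (if u ∈ T ∧ v ∈ T then w u v else 0) ≠ 0 := by
    intro h0
    simp only [Finset.sum_eq_zero_iff, Finset.mem_univ, true_implies] at h0
    exact hxy (by simpa [hx, hy] using h0 x y)
  have h3 : ∑ u, ∑ v, (if u ∉ T ∧ v ∈ T then w u v else 0) +
      ∑ u, ∑ v, (if u ∈ T ∧ v ∈ T then w u v else 0) = T.ncard * r := by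
    simp only [← Finset.sum_add_distrib]
    rw [Finset.sum_comm]
    calc _ = ∑ v, if v ∈ T then r else 0 := by
          refine Finset.sum_congr rfl fun v _ => ?_
          rw [← h.regular v, cutWeight_singleton (h.diag v)]
          by_cases hv : v ∈ T
          · simp only [hv, and_true, if_true]
            refine Finset.sum_congr rfl fun u _ => ?_
            by_cases hu : u ∈ T <;> simp [hu, h.symm u v]
          · simp [hv]
      _ = _ := by
        rw [← Finset.sum_filter, Finset.sum_const, smul_eq_mul, Set.ncard_eq_toFinset_card']
        congr 2
        ext; simp
  have h4 : Fintype.card ι * r < T.ncard * r := by omega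
  exact lt_of_mul_lt_mul_right h4 (Nat.zero_le r)

theorem IsRGraph.exists_isMatchingWeight (h : IsRGraph w r) (hr : 0 < r) {x y : V}
    (hxy : w x y ≠ 0) : ∃ m, IsMatchingWeight w m ∧ m x y ≠ 0 := by
  have hne : x ≠ y := fun e => hxy (e ▸ h.diag x)
  let H : SimpleGraph {v // v ≠ x ∧ v ≠ y} :=
    { Adj := fun a b => w a b ≠ 0
      symm := ⟨fun a b hab => by rwa [h.symm]⟩
      loopless := ⟨fun a ha => ha (h.diag a)⟩ }
  by_cases hM : ∃ M : H.Subgraph, M.IsPerfectMatching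
  · obtain ⟨M, hM⟩ := hM
    rw [SimpleGraph.Subgraph.isPerfectMatching_iff] at hM
    let P : V → V → Prop := fun u v =>
      (u = x ∧ v = y) ∨ (u = y ∧ v = x) ∨ ∃ hu hv, M.Adj ⟨u, hu⟩ ⟨v, hv⟩
    refine ⟨_, isMatchingWeight_of_existsUnique (P := P) h.diag ?_ ?_ ?_, ?_⟩
    · rintro u v (⟨rfl, rfl⟩ | ⟨rfl, rfl⟩ | ⟨hu, hv, huv⟩)
      · exact .inr (.inl ⟨rfl, rfl⟩)
      · exact .inl ⟨rfl, rfl⟩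
      · exact .inr (.inr ⟨hv, hu, huv.symm⟩)
    · rintro u v (⟨rfl, rfl⟩ | ⟨rfl, rfl⟩ | ⟨hu, hv, huv⟩)
      · exact hxy
      · rwa [h.symm]
      · exact M.adj_sub huv
    · intro u
      by_cases hux : u = x
      · refine ⟨y, .inl ⟨hux, rfl⟩, ?_⟩
        rintro v (⟨-, rfl⟩ | ⟨rfl, -⟩ | ⟨hu, -, -⟩)
        exacts [rfl, (hne hux.symm).elim, (hu.1 hux).elim]
      · by_cases huy : u = y
        · refine ⟨x, .inr (.inl ⟨huy, rfl⟩), ?_⟩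
          rintro v (⟨rfl, -⟩ | ⟨-, rfl⟩ | ⟨hu, -, -⟩)
          exacts [(hux rfl).elim, rfl, (hu.2 huy).elim]
        · obtain ⟨v, hv, huniq⟩ := hM ⟨u, hux, huy⟩
          refine ⟨v, .inr (.inr ⟨⟨hux, huy⟩, v.2, hv⟩), ?_⟩
          rintro v' (⟨rfl, -⟩ | ⟨rfl, -⟩ | ⟨hu, hv', huv'⟩)
          exacts [(hux rfl).elim, (huy rfl).elim, congrArg Subtype.val (huniq _ huv')]
    · simp [P]
  · exfalso
    rw [SimpleGraph.tutte] at hM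
    push Not at hM
    obtain ⟨S, hS⟩ := hM
    unfold SimpleGraph.IsTutteViolator at hS
    set K := ((⊤ : H.Subgraph).deleteVerts S).coe with hK
    have hcard := h.even_card hr
    have hparity := K.odd_ncard_oddComponents
    have hverts : Nat.card ((⊤ : H.Subgraph).deleteVerts S).verts = Sᶜ.ncard := by
      rw [Nat.card_coe_set_eq, Set.compl_eq_univ_sdiff]
      rfl
    have hS1 := Set.ncard_add_ncard_compl S
    have hU : Nat.card {v // v ≠ x ∧ v ≠ y} + 2 = Nat.card V := by
      have h1 := Set.ncard_add_ncard_compl ({x, y} : Set V)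
      rw [Set.ncard_pair hne] at h1
      have h2 : Nat.card {v // v ≠ x ∧ v ≠ y} = ({x, y}ᶜ : Set V).ncard := by
        rw [← Nat.card_coe_set_eq]
        exact Nat.card_congr (Equiv.subtypeEquivRight fun v => by simp)
      omega
    -- The number of vertices left is even, so the number of odd components has the parity of
    -- `S.ncard`; a violation is thus by at least 2.
    have hbig : S.ncard + 2 ≤ K.oddComponents.ncard := by
      have hlt : S.ncard < K.oddComponents.ncard := hS
      rw [hverts, Nat.odd_iff, Nat.odd_iff] at hparity
      rw [Nat.even_iff] at hcard
      generalize K.oddComponents.ncard = k at hlt hparity ⊢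
      omega
    let f : ((⊤ : H.Subgraph).deleteVerts S).verts → V := fun a => a.1.1
    have hf : Function.Injective f := fun a b hab => Subtype.ext (Subtype.ext hab)
    -- Restoring `x` and `y` costs exactly the 2 gained by parity, and puts the edge `xy` inside
    -- `T`.
    let T : Set V := insert x (insert y (Subtype.val '' S))
    have hT : T.ncard ≤ S.ncard + 2 := by
      have h1 : T.ncard ≤ _ := Set.ncard_insert_le x (insert y (Subtype.val '' S))
      have h2 := Set.ncard_insert_le y (Subtype.val '' S)
      have h3 := Set.ncard_image_le (f := (Subtype.val : {v // v ≠ x ∧ v ≠ y} → V)) S.toFinite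
      omega
    have hlt := h.card_lt_ncard (T := T) (x := x) (y := y) (by simp [T]) (by simp [T]) hxy
      (ι := K.oddComponents) (fun c => f '' c.1.supp)
      (fun c => by rw [Set.ncard_image_of_injective _ hf]; exact c.2)
      (by
        rintro c d _ ⟨a, ha, rfl⟩ ⟨b, hb, hab⟩
        obtain rfl := hf hab
        exact Subtype.ext (ha.symm.trans hb))
      (by
        rintro c _ ⟨a, ha, rfl⟩ hT
        rcases hT with hT | hT | ⟨s, hs, hsa⟩
        · exact a.1.2.1 hT
        · exact a.1.2.2 hT
        · exact a.2.2 ((Subtype.ext hsa : s = a.1) ▸ hs))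
      (by
        rintro c _ ⟨a, ha, rfl⟩ v hv hw
        by_contra hvT
        simp only [T, Set.mem_insert_iff, not_or] at hvT
        let v' : {v // v ≠ x ∧ v ≠ y} := ⟨v, hvT.1, hvT.2.1⟩
        have hv'S : v' ∉ S := fun hs => hvT.2.2 ⟨v', hs, rfl⟩
        let b : ((⊤ : H.Subgraph).deleteVerts S).verts := ⟨v', trivial, hv'S⟩
        have hab : K.Adj a b := by
          rw [hK, SimpleGraph.Subgraph.coe_adj, SimpleGraph.Subgraph.deleteVerts_adj]
          exact ⟨trivial, a.2.2, trivial, hv'S, hw⟩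
        exact hv ⟨b, (SimpleGraph.ConnectedComponent.connectedComponentMk_eq_of_adj hab).symm.trans ha,
          rfl⟩)
    rw [← Nat.card_eq_fintype_card, Nat.card_coe_set_eq] at hlt
    omega

end MatchingWeights

/-! ### Gluing matchings and meeting all tight cuts once -/

section TightCuts

open scoped Classical

theorem IsMatchingWeight.diag {V : Type*} [Fintype V] {w m : V → V → ℕ}
    (hm : IsMatchingWeight w m) (hw : ∀ v, w v v = 0) (v : V) : m v v = 0 := by
  by_contra h
  exact hm.support v v h (hw v)

theorem IsMatchingWeight.sum_eq_one {V : Type*} [Fintype V] {w m : V → V → ℕ}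
    (hm : IsMatchingWeight w m) (hw : ∀ v, w v v = 0) (v : V) : ∑ u, m v u = 1 := by
  rw [← cutWeight_singleton (hm.diag hw v), hm.regular]

theorem IsMatchingWeight.exists_ne_zero {V : Type*} [Fintype V] {w m : V → V → ℕ}
    (hm : IsMatchingWeight w m) (hw : ∀ v, w v v = 0) (v : V) : ∃ u, m v u ≠ 0 := by
  by_contra! h
  simpa [h] using hm.sum_eq_one hw v

theorem IsMatchingWeight.eq_of_ne_zero {V : Type*} [Fintype V] {w m : V → V → ℕ}
    (hm : IsMatchingWeight w m) (hw : ∀ v, w v v = 0) {v a b : V} (ha : m v a ≠ 0)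
    (hb : m v b ≠ 0) : a = b := by
  by_contra hab
  have h1 := hm.sum_eq_one hw v
  have h2 := Finset.sum_le_sum_of_subset (f := m v) (Finset.subset_univ {a, b})
  rw [Finset.sum_pair hab] at h2
  omega

variable {V : Type u} [Fintype V] {X : Set V}

theorem sum_contractMap (g : Option {v // v ∉ X} → ℕ) :
    (∑ v, if v ∈ X then 0 else g (contractMap X v)) + g none = ∑ o, g o := by
  have h := Finset.sum_subtype (F := inferInstance) (p := fun v => v ∉ X) (Finset.univ.filter (· ∉ X)) (by simp)
    (fun v => g (contractMap X v))
  rw [Finset.sum_filter] at h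
  rw [Fintype.sum_option, add_comm]
  congr 1
  trans ∑ v, if v ∉ X then g (contractMap X v) else 0
  · exact Finset.sum_congr rfl fun v _ => (ite_not _ _ _).symm
  · rw [h]
    exact Finset.sum_congr rfl fun v _ => by rw [contractMap_of_notMem v.2]

theorem contractWeight_some_ne_zero {w : V → V → ℕ} {u v : V} (hu : u ∉ X) (hv : v ∉ X)
    (h : contractWeight (contractMap X) w (contractMap X u) (contractMap X v) ≠ 0) :
    w u v ≠ 0 := by
  intro h0
  apply h
  unfold contractWeight
  split_ifs
  · rfl
  · refine Finset.sum_eq_zero fun a _ => Finset.sum_eq_zero fun b _ => ?_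
    simp only [contractMap_of_notMem hu, contractMap_of_notMem hv, contractMap_eq_some]
    split_ifs with h
    · rw [h.1, h.2, h0]
    · rfl

theorem exists_of_contractWeight_none_ne_zero {w : V → V → ℕ} {v : V} (hv : v ∉ X)
    (h : contractWeight (contractMap X) w none (contractMap X v) ≠ 0) :
    ∃ u ∈ X, w u v ≠ 0 := by
  by_contra! h0
  apply h
  unfold contractWeight
  split_ifs
  · rfl
  · refine Finset.sum_eq_zero fun a _ => Finset.sum_eq_zero fun b _ => ?_
    simp only [contractMap_of_notMem hv, contractMap_eq_some, contractMap_eq_none]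
    split_ifs with h
    · rw [h.2, h0 a h.1]
    · rfl

theorem contractWeight_eq_of_sum_eq {m : V → V → ℕ} (hm : ∀ u v, m u v = m v u)
    {m₁ : Option {v // v ∉ X} → Option {v // v ∉ X} → ℕ} (hsymm : ∀ u v, m₁ u v = m₁ v u)
    (hdiag : ∀ v, m₁ v v = 0)
    (hout : ∀ u ∉ X, ∀ v ∉ X, m u v = m₁ (contractMap X u) (contractMap X v))
    (hsum : ∀ v ∉ X, (∑ u, if u ∈ X then m u v else 0) = m₁ none (contractMap X v)) :
    contractWeight (contractMap X) m = m₁ := by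
  have key : ∀ v : {v // v ∉ X},
      contractWeight (contractMap X) m none (some v) = m₁ none (some v) := by
    rintro ⟨v, hv⟩
    have := hsum v hv
    rw [contractMap_of_notMem hv] at this
    rw [← this, contractWeight, if_neg (by simp)]
    refine Finset.sum_congr rfl fun u _ => ?_
    by_cases hu : u ∈ X <;> simp [hu]
  funext a b
  cases a with
  | none =>
    cases b with
    | none => simp [contractWeight, hdiag]
    | some v => exact key v
  | some u =>
    cases b with
    | none => rw [contractWeight_symm _ hm, hsymm, key]
    | some v =>
      by_cases huv : u = v
      · simp [contractWeight, huv, hdiag]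
      · rw [contractWeight, if_neg (by simpa using huv)]
        simp only [contractMap_eq_some, ite_and]
        rw [Finset.sum_comm]
        simp [hout _ u.2 _ v.2, contractMap_of_notMem u.2, contractMap_of_notMem v.2]

/-- The union of a matching of the graph with `X` collapsed and one of the graph with its complement
`Z` collapsed. -/
noncomputable def glueWeight (X Z : Set V) (m₁ : Option {v // v ∉ X} → Option {v // v ∉ X} → ℕ)
    (m₂ : Option {v // v ∉ Z} → Option {v // v ∉ Z} → ℕ) (u v : V) : ℕ :=
  -- Each factor singles out one partner of a collapsed vertex, so the product is the indicator of a
  -- single crossing pair.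
  if u ∈ X then
    if v ∈ X then m₂ (contractMap Z u) (contractMap Z v)
    else m₁ none (contractMap X v) * m₂ none (contractMap Z u)
  else
    if v ∈ X then m₁ none (contractMap X u) * m₂ none (contractMap Z v)
    else m₁ (contractMap X u) (contractMap X v)

section Glue

variable {Z : Set V}

variable {w₁ m₁ : Option {v // v ∉ X} → Option {v // v ∉ X} → ℕ}
  {w₂ m₂ : Option {v // v ∉ Z} → Option {v // v ∉ Z} → ℕ}

theorem glueWeight_symm (h₁ : IsMatchingWeight w₁ m₁) (h₂ : IsMatchingWeight w₂ m₂) (u v : V) :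
    glueWeight X Z m₁ m₂ u v = glueWeight X Z m₁ m₂ v u := by
  unfold glueWeight
  split_ifs
  exacts [h₂.symm _ _, rfl, rfl, h₁.symm _ _]

/-- The row of `m₂` at the collapsed vertex sums to 1, so summing the product over `X` leaves `m₁`.
-/
theorem contractWeight_glueWeight (hZ : ∀ v, v ∈ Z ↔ v ∉ X) (h₁ : IsMatchingWeight w₁ m₁) (h₂ : IsMatchingWeight w₂ m₂)
    (hd₁ : ∀ v, w₁ v v = 0) (hd₂ : ∀ v, w₂ v v = 0) :
    contractWeight (contractMap X) (glueWeight X Z m₁ m₂) = m₁ := by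
  refine contractWeight_eq_of_sum_eq (glueWeight_symm h₁ h₂) h₁.symm (h₁.diag hd₁) ?_ ?_
  · intro u hu v hv
    simp [glueWeight, hu, hv]
  · intro v hv
    have h := sum_contractMap (X := Z) (m₂ none)
    rw [h₂.sum_eq_one hd₂, h₂.diag hd₂, add_zero] at h
    rw [← mul_one (m₁ none (contractMap X v)), ← h, Finset.mul_sum]
    refine Finset.sum_congr rfl fun u _ => ?_
    by_cases hu : u ∈ X
    · simp only [glueWeight, hu, hv, hZ, not_true, if_true, if_false]
    · simp only [hu, hZ, not_false_eq_true, if_true, if_false, mul_zero]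

theorem contractWeight_compl_glueWeight (hZ : ∀ v, v ∈ Z ↔ v ∉ X) (h₁ : IsMatchingWeight w₁ m₁)
    (h₂ : IsMatchingWeight w₂ m₂) (hd₁ : ∀ v, w₁ v v = 0) (hd₂ : ∀ v, w₂ v v = 0) :
    contractWeight (contractMap Z) (glueWeight X Z m₁ m₂) = m₂ := by
  refine contractWeight_eq_of_sum_eq (glueWeight_symm h₁ h₂) h₂.symm (h₂.diag hd₂) ?_ ?_
  · intro u hu v hv
    rw [hZ, not_not] at hu hv
    simp only [glueWeight, hu, hv, if_true]
  · intro v hv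
    rw [hZ, not_not] at hv
    have h := sum_contractMap (X := X) (m₁ none)
    rw [h₁.sum_eq_one hd₁, h₁.diag hd₁, add_zero] at h
    rw [← one_mul (m₂ none (contractMap Z v)), ← h, Finset.sum_mul]
    refine Finset.sum_congr rfl fun u _ => ?_
    by_cases hu : u ∈ X
    · simp only [hu, hZ, not_true, if_true, if_false, zero_mul]
    · simp only [glueWeight, hu, hv, hZ, not_false_eq_true, if_true, if_false]

end Glue

theorem IsRGraph.exists_isMatchingWeight_tight (n : ℕ) :
    ∀ (V : Type u) [Fintype V] (w : V → V → ℕ) (r : ℕ), Fintype.card V = n → IsRGraph w r →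
      0 < r → ∀ x y, w x y ≠ 0 → ∃ m, IsMatchingWeight w m ∧ m x y ≠ 0 ∧
        ∀ Y : Set V, Odd Y.ncard → cutWeight w Y = r → cutWeight m Y = 1 := by
  induction n using Nat.strong_induction_on with
  | _ n ih =>
  intro V _ w r hn hw hr x y hxy
  by_cases hX : ∃ X : Set V, Odd X.ncard ∧ cutWeight w X = r ∧ 2 ≤ X.ncard ∧ 2 ≤ Xᶜ.ncard
  · obtain ⟨X, hXodd, hXr, hX2, hXc2, hyX⟩ : ∃ X : Set V, Odd X.ncard ∧ cutWeight w X = r ∧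
        2 ≤ X.ncard ∧ 2 ≤ Xᶜ.ncard ∧ y ∉ X := by
      -- Complementing `X` if necessary, assume `y ∉ X`.
      obtain ⟨X, hXodd, hXr, hX2, hXc2⟩ := hX
      by_cases hy : y ∈ X
      · exact ⟨Xᶜ, hw.odd_compl hr hXodd, by rw [cutWeight_compl hw.symm, hXr], hXc2,
          by rwa [compl_compl], by simpa using hy⟩
      · exact ⟨X, hXodd, hXr, hX2, hXc2, hy⟩
    have hne : x ≠ y := fun e => hxy (e ▸ hw.diag x)
    have hw₁ := hw.contract hXodd hXr
    obtain ⟨Z, hZX⟩ : ∃ Z, Z = Xᶜ := ⟨_, rfl⟩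
    have hZ : ∀ v, v ∈ Z ↔ v ∉ X := fun v => by rw [hZX, Set.mem_compl_iff]
    have hZodd : Odd Z.ncard := hZX ▸ hw.odd_compl hr hXodd
    have hw₂ := hw.contract hZodd (by rw [hZX, cutWeight_compl hw.symm, hXr])
    have hxy' : contractMap X x ≠ contractMap X y := by
      rw [contractMap_of_notMem hyX, Ne, contractMap_eq_some]
      exact hne
    obtain ⟨m₁, hm₁, hm₁xy, ht₁⟩ := ih _ (hn ▸ card_contractMap_lt hX2) _ _ r rfl hw₁ hr
      (contractMap X x) (contractMap X y)
      (fun h0 => hxy (Nat.le_zero.1 (h0 ▸ le_contractWeight _ _ hxy')))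
    -- Lift the edge of `m₁` at the collapsed vertex to an edge `ab` of `w`, taking `xy` itself when
    -- it crosses.
    obtain ⟨a, ha, b, hb, hab, hmb, hxa⟩ : ∃ a ∈ X, ∃ b ∉ X, w a b ≠ 0 ∧
        m₁ none (contractMap X b) ≠ 0 ∧ (x ∈ X → a = x ∧ b = y) := by
      by_cases hx : x ∈ X
      · refine ⟨x, hx, y, hyX, hxy, ?_, fun _ => ⟨rfl, rfl⟩⟩
        rwa [contractMap_of_mem hx] at hm₁xy
      · obtain ⟨o, ho⟩ := hm₁.exists_ne_zero hw₁.diag none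
        have hwo := hm₁.support _ _ ho
        cases o with
        | none => exact (hwo (hw₁.diag none)).elim
        | some b =>
          rw [← contractMap_of_notMem b.2] at ho hwo
          obtain ⟨a, ha, hab⟩ := exists_of_contractWeight_none_ne_zero b.2 hwo
          exact ⟨a, ha, b, b.2, hab, ho, fun h => (hx h).elim⟩
    have hac : a ∉ Z := by simpa [hZ] using ha
    have hbc : b ∈ Z := (hZ b).2 hb
    -- Forcing `m₂` through `a` makes both matchings agree on the crossing edge `ab`.
    obtain ⟨m₂, hm₂, hma, ht₂⟩ := ih _ (hn ▸ card_contractMap_lt (hZX ▸ hXc2 : 2 ≤ Z.ncard)) _ _ r rfl hw₂ hr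
      none (contractMap Z a) (by
        intro h0
        have h := le_contractWeight (contractMap Z) w (u := b) (v := a)
          (by rw [contractMap_of_mem hbc, contractMap_of_notMem hac]; simp)
        rw [contractMap_of_mem hbc, h0, hw.symm] at h
        exact hab (Nat.le_zero.1 h))
    have hc₁ := contractWeight_glueWeight hZ hm₁ hm₂ hw₁.diag hw₂.diag
    have hc₂ := contractWeight_compl_glueWeight hZ hm₁ hm₂ hw₁.diag hw₂.diag
    have hsymm := glueWeight_symm hm₁ hm₂
    have hcross : ∀ u ∈ X, ∀ v ∉ X, m₁ none (contractMap X v) * m₂ none (contractMap Z u) ≠ 0 →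
        w u v ≠ 0 := by
      intro u hu v hv h
      have h1 := hm₁.eq_of_ne_zero hw₁.diag (left_ne_zero_of_mul h) hmb
      have h2 := hm₂.eq_of_ne_zero hw₂.diag (right_ne_zero_of_mul h) hma
      rw [contractMap_of_notMem hb, contractMap_eq_some] at h1
      rw [contractMap_of_notMem hac, contractMap_eq_some] at h2
      subst h1 h2
      exact hab
    have hm : IsMatchingWeight w (glueWeight X Z m₁ m₂) := by
      refine ⟨hsymm, fun u v h => ?_, fun v => ?_⟩
      · unfold glueWeight at h
        by_cases hu : u ∈ X <;> by_cases hv : v ∈ X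
        · rw [if_pos hu, if_pos hv] at h
          exact contractWeight_some_ne_zero (by simpa [hZ] using hu) (by simpa [hZ] using hv)
            (hm₂.support _ _ h)
        · rw [if_pos hu, if_neg hv] at h
          exact hcross u hu v hv h
        · rw [if_neg hu, if_pos hv] at h
          rw [hw.symm]
          exact hcross v hv u hu h
        · rw [if_neg hu, if_neg hv] at h
          exact contractWeight_some_ne_zero hu hv (hm₁.support _ _ h)
      · by_cases hv : v ∈ X
        · have h := hm₂.regular (some ⟨v, by simpa [hZ] using hv⟩)
          rwa [← hc₂, cutWeight_contractWeight, contractMap_preimage_some] at h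
        · have h := hm₁.regular (some ⟨v, hv⟩)
          rwa [← hc₁, cutWeight_contractWeight, contractMap_preimage_some] at h
    have htX : ∀ S : Set V, Odd S.ncard → cutWeight w S = r → X ⊆ S ∨ Disjoint X S →
        cutWeight (glueWeight X Z m₁ m₂) S = 1 := by
      intro S hS hSr hXS
      obtain ⟨Y, rfl⟩ := exists_contractMap_preimage_eq hXS
      rw [← cutWeight_contractWeight] at hSr ⊢
      rw [hc₁]
      exact ht₁ Y ((odd_ncard_contractMap_preimage hXodd Y).1 hS) hSr
    have htXc : ∀ S : Set V, Odd S.ncard → cutWeight w S = r → Z ⊆ S ∨ Disjoint Z S →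
        cutWeight (glueWeight X Z m₁ m₂) S = 1 := by
      intro S hS hSr hZS
      obtain ⟨Y, rfl⟩ := exists_contractMap_preimage_eq hZS
      rw [← cutWeight_contractWeight] at hSr ⊢
      rw [hc₂]
      exact ht₂ Y ((odd_ncard_contractMap_preimage hZodd Y).1 hS) hSr
    -- When `X ∩ Y` is odd, so is `X ∪ Y`. Uncrossing makes both tight with no cross weight; neither
    -- splits one of the contracted sides, so the matching meets each once, and the same identity
    -- for the matching leaves 1 for `Y`.
    have hodd : ∀ Y : Set V, Odd Y.ncard → cutWeight w Y = r → Odd (X ∩ Y).ncard →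
        cutWeight (glueWeight X Z m₁ m₂) Y = 1 := by
      intro Y hY hYr hXY
      have hun : Odd (X ∪ Y).ncard := by
        have := Set.ncard_union_add_ncard_inter X Y
        grind
      have h1 := cutWeight_uncross hw.symm X Y
      have h2 := hw.odd_cut _ hXY
      have h3 := hw.odd_cut _ hun
      have h4 := cutWeight_uncross hsymm X Y
      rw [crossWeight_eq_zero_of_support hm.support (by omega),
        htXc (X ∩ Y) hXY (by omega) (.inr (by
          rw [Set.disjoint_left]; exact fun v hv hv' => (hZ v).1 hv hv'.1)),
        htX (X ∪ Y) hun (by omega) (.inl Set.subset_union_left),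
        htX X hXodd hXr (.inl subset_rfl)] at h4
      omega
    refine ⟨_, hm, ?_, fun Y hY hYr => ?_⟩
    · by_cases hx : x ∈ X
      · obtain ⟨rfl, rfl⟩ := hxa hx
        rw [glueWeight, if_pos hx, if_neg hyX]
        exact mul_ne_zero hmb hma
      · rwa [glueWeight, if_neg hx, if_neg hyX]
    · by_cases hXY : Odd (X ∩ Y).ncard
      · exact hodd Y hY hYr hXY
      · rw [← cutWeight_compl hsymm]
        refine hodd _ (hw.odd_compl hr hY) (by rwa [cutWeight_compl hw.symm]) ?_
        have := Set.ncard_inter_add_ncard_sdiff_eq_ncard X Y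
        rw [Set.sdiff_eq] at this
        grind
  · obtain ⟨m, hm, hmxy⟩ := hw.exists_isMatchingWeight hr hxy
    -- Every tight odd cut now has a single vertex on one side, where regularity suffices.
    have h1 : ∀ Y : Set V, Odd Y.ncard → Y.ncard < 2 → cutWeight m Y = 1 := by
      intro Y hY hY2
      have h1 : Y.ncard = 1 := by
        have := hY.pos
        omega
      obtain ⟨v, rfl⟩ := Set.ncard_eq_one.1 h1
      exact hm.regular v
    refine ⟨m, hm, hmxy, fun Y hY hYr => ?_⟩
    by_cases hY2 : Y.ncard < 2
    · exact h1 Y hY hY2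
    · rw [← cutWeight_compl hm.symm]
      refine h1 _ (hw.odd_compl hr hY) ?_
      by_contra hYc
      exact hX ⟨Y, hY, hYr, by omega, by omega⟩

end TightCuts

/-! ### Building the matchings successively -/

section CubicGraphs

open scoped Classical

variable {V : Type u} [Fintype V]

theorem IsMatchingWeight.le {w m : V → V → ℕ} (hm : IsMatchingWeight w m) (hw : ∀ v, w v v = 0)
    (u v : V) : m u v ≤ w u v := by
  by_cases h : m u v = 0
  · omega
  · have h1 := hm.support u v h
    have h2 := Finset.single_le_sum (f := m u) (fun _ _ => Nat.zero_le _) (Finset.mem_univ v)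
    rw [hm.sum_eq_one hw u] at h2
    omega

theorem IsRGraph.exists_matchingWeights [Nonempty V] {A : V → V → ℕ} (hA : IsRGraph A 3) (t : ℕ) :
    ∃ (w : V → V → ℕ) (m : Fin t → V → V → ℕ), IsRGraph w (2 * t + 3) ∧
      (∀ i, IsMatchingWeight A (m i)) ∧ ∀ u v, w u v + ∑ i, m i u v = (t + 1) * A u v := by
  induction t with
  | zero => exact ⟨A, Fin.elim0, hA, fun i => i.elim0, fun u v => by simp⟩
  | succ t ih =>
    obtain ⟨w, m, hw, hm, hsum⟩ := ih
    obtain ⟨x, y, hxy⟩ : ∃ x y, w x y ≠ 0 := by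
      by_contra! h
      have := hw.regular (Classical.arbitrary V)
      simp [cutWeight, h] at this
    obtain ⟨m', hm', -, ht⟩ :=
      IsRGraph.exists_isMatchingWeight_tight _ V w _ rfl hw (by omega) x y hxy
    have hmA : IsMatchingWeight A m' := by
      refine ⟨hm'.symm, fun u v h h0 => hm'.support u v h ?_, hm'.regular⟩
      -- Where `A` vanishes, the sum identity forces `w` to vanish.
      have := hsum u v
      rw [h0, mul_zero] at this
      omega
    have hle := hmA.le hA.diag
    have hcut : ∀ Y, cutWeight (fun u v => w u v + (A u v - m' u v)) Y + cutWeight m' Y =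
        cutWeight w Y + cutWeight A Y := by
      intro Y
      rw [← cutWeight_add, ← cutWeight_add]
      congr 1
      funext u v
      have := hle u v
      omega
    -- Since `m' ≤ A`, the natural-number subtraction is exact.
    refine ⟨fun u v => w u v + (A u v - m' u v), Fin.snoc m m', ⟨?_, ?_, ?_, ?_⟩, ?_, ?_⟩
    · intro u v
      rw [hw.symm, hA.symm, hm'.symm]
    · intro v
      simp [hw.diag, hA.diag]
    · intro v
      have := hcut {v}
      rw [hm'.regular, hw.regular, hA.regular] at this
      omega
    · intro Y hY
      have h1 := hcut Y
      have h2 := hw.odd_cut Y hY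
      have h3 := hA.odd_cut Y hY
      have h4 := cutWeight_mono hle Y
      by_cases hYt : cutWeight w Y = 2 * t + 3
      · have := ht Y hY hYt
        omega
      · have h5 := cutWeight_modEq hw.symm hw.regular Y
        have h6 : Odd ((2 * t + 3) * Y.ncard) := Odd.mul ⟨t + 1, by omega⟩ hY
        rw [Nat.odd_iff] at h6
        unfold Nat.ModEq at h5
        omega
    · intro i
      induction i using Fin.lastCases with
      | last => simpa using hmA
      | cast i => simpa using hm i
    · intro u v
      have h1 := hsum u v
      have h2 := hle u v
      rw [Fin.sum_univ_castSucc]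
      simp only [Fin.snoc_castSucc, Fin.snoc_last]
      rw [add_mul (t + 1) 1, one_mul]
      omega

/-! ### Back to simple graphs: edge cuts and perfect matchings -/

namespace SimpleGraph

/-- The adjacency function with values in `ℕ`. -/
noncomputable def adjWeight {V : Type*} (G : SimpleGraph V) (u v : V) : ℕ := if G.Adj u v then 1 else 0

variable {G : SimpleGraph V}

theorem adjWeight_symm {V : Type*} {G : SimpleGraph V} (u v : V) : G.adjWeight u v = G.adjWeight v u :=
  if_congr (G.adj_comm u v) rfl rfl

theorem cutWeight_adjWeight (Y : Set V) :
    cutWeight G.adjWeight Y = {p : V × V | p.1 ∈ Y ∧ p.2 ∉ Y ∧ G.Adj p.1 p.2}.ncard := by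
  rw [Set.ncard_eq_toFinset_card', cutWeight, ← Finset.sum_product', Finset.univ_product_univ]
  simp only [adjWeight, ← ite_and, Finset.sum_boole, Nat.cast_id, and_assoc]
  congr 1
  ext
  simp

theorem cutWeight_adjWeight_singleton [DecidableRel G.Adj] (v : V) :
    cutWeight G.adjWeight {v} = G.degree v := by
  rw [cutWeight_singleton (by simp [adjWeight]), ← G.card_neighborFinset_eq_degree,
    neighborFinset_eq_filter, Finset.card_filter]
  exact Finset.sum_congr rfl fun u _ => by simp [adjWeight]

theorem Bridgeless.cutWeight_ne_one (h : G.Bridgeless) (Y : Set V) :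
    cutWeight G.adjWeight Y ≠ 1 := by
  rw [cutWeight_adjWeight, Ne, Set.ncard_eq_one]
  rintro ⟨⟨u, v⟩, huv⟩
  have hmem : (u, v) ∈ {p : V × V | p.1 ∈ Y ∧ p.2 ∉ Y ∧ G.Adj p.1 p.2} := huv ▸ rfl
  refine h s(u, v) hmem.2.2 ?_
  rw [isBridge_iff]
  rintro ⟨p⟩
  obtain ⟨d, -, hd1, hd2⟩ := p.exists_boundary_dart Y hmem.1 hmem.2.1
  have hd := d.adj
  rw [deleteEdges_adj] at hd
  have : (d.fst, d.snd) ∈ {p : V × V | p.1 ∈ Y ∧ p.2 ∉ Y ∧ G.Adj p.1 p.2} := ⟨hd1, hd2, hd.1⟩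
  rw [huv, Set.mem_singleton_iff, Prod.mk.injEq] at this
  exact hd.2 (by rw [this.1, this.2]; rfl)

theorem isRGraph_adjWeight [DecidableRel G.Adj] (hcubic : G.IsRegularOfDegree 3)
    (hb : G.Bridgeless) : IsRGraph G.adjWeight 3 where
  symm := adjWeight_symm
  diag v := by simp [adjWeight]
  regular v := by rw [cutWeight_adjWeight_singleton, hcubic v]
  odd_cut Y hY := by
    have h1 := cutWeight_modEq (r := 3) (adjWeight_symm (G := G))
      (fun v => by rw [cutWeight_adjWeight_singleton, hcubic v]) Y
    have h2 := hb.cutWeight_ne_one Y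
    rw [Nat.odd_iff] at hY
    unfold Nat.ModEq at h1
    omega

/-- The set of edges with exactly one end in `Y`. -/
def edgeCut {V : Type*} (G : SimpleGraph V) (Y : Set V) : Set (Sym2 V) :=
  (fun p : V × V => s(p.1, p.2)) '' {p | p.1 ∈ Y ∧ p.2 ∉ Y ∧ G.Adj p.1 p.2}

theorem mk_mem_edgeCut {V : Type*} {G : SimpleGraph V} {Y : Set V} {u v : V} (hu : u ∈ Y) (hv : v ∉ Y) (h : G.Adj u v) :
    s(u, v) ∈ G.edgeCut Y := ⟨(u, v), ⟨hu, hv, h⟩, rfl⟩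

theorem ncard_edgeCut (Y : Set V) : (G.edgeCut Y).ncard = cutWeight G.adjWeight Y := by
  rw [edgeCut, cutWeight_adjWeight, Set.InjOn.ncard_image]
  rintro ⟨a, b⟩ ⟨ha, hb, -⟩ ⟨c, d⟩ ⟨hc, hd, -⟩ h
  rcases Sym2.eq_iff.1 h with ⟨h1, h2⟩ | ⟨h1, h2⟩
  · exact Prod.ext h1 h2
  · exact (hb ((show b = c from h2).symm ▸ hc)).elim

/-- The boundary of a component of `G ∖ C` lies in `C` and already separates `G`, so minimality
gives equality. -/
theorem IsMinimalCut.exists_eq_edgeCut (hG : G.Connected) {C : Set (Sym2 V)}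
    (hC : G.IsMinimalCut C) : ∃ Y, C = G.edgeCut Y := by
  have hcard : Nat.card G.ConnectedComponent = 1 := by
    have := hG.nonempty
    have := hG.preconnected.subsingleton_connectedComponent
    exact Nat.card_unique
  obtain ⟨⟨-, hlt⟩, hmin⟩ := hC
  rw [hcard, Finite.one_lt_card_iff_nontrivial] at hlt
  obtain ⟨K, L, hKL⟩ := hlt
  obtain ⟨a, ha⟩ := K.nonempty_supp
  obtain ⟨b, hb⟩ := L.nonempty_supp
  have hbK : b ∉ K.supp := fun h => hKL (h.symm.trans hb)
  have hsub : G.edgeCut K.supp ⊆ C := by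
    rintro _ ⟨⟨u, v⟩, ⟨hu, hv, huv⟩, rfl⟩
    by_contra hc
    have hadj : (G.deleteEdges C).Adj u v := deleteEdges_adj.2 ⟨huv, hc⟩
    exact hv ((ConnectedComponent.connectedComponentMk_eq_of_adj hadj).symm.trans hu)
  refine ⟨K.supp, (hmin ⟨?_, ?_⟩ hsub).antisymm hsub⟩
  · rintro _ ⟨⟨u, v⟩, ⟨-, -, huv⟩, rfl⟩
    exact huv
  · rw [hcard, Finite.one_lt_card_iff_nontrivial]
    refine ⟨connectedComponentMk _ a, connectedComponentMk _ b, fun h => ?_⟩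
    obtain ⟨p⟩ := ConnectedComponent.exact h
    obtain ⟨d, -, hd1, hd2⟩ := p.exists_boundary_dart K.supp ha hbK
    have hd := deleteEdges_adj.1 d.adj
    exact hd.2 (mk_mem_edgeCut hd1 hd2 hd.1)

/-- The spanning subgraph on the support of a matching weight. -/
def matchingSubgraph {m : V → V → ℕ} (hm : IsMatchingWeight G.adjWeight m) : G.Subgraph where
  verts := Set.univ
  Adj u v := m u v ≠ 0
  adj_sub {u v} h := by
    by_contra h'
    exact hm.support u v h (if_neg h')
  edge_vert _ := trivial
  symm := ⟨fun u v h => by rwa [hm.symm]⟩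

theorem isPerfectMatching_matchingSubgraph {m : V → V → ℕ}
    (hm : IsMatchingWeight G.adjWeight m) : (matchingSubgraph hm).IsPerfectMatching := by
  have hdiag : ∀ v, G.adjWeight v v = 0 := fun v => by simp [adjWeight]
  rw [Subgraph.isPerfectMatching_iff]
  intro v
  obtain ⟨u, hu⟩ := hm.exists_ne_zero hdiag v
  exact ⟨u, hu, fun u' hu' => hm.eq_of_ne_zero hdiag hu' hu⟩

end SimpleGraph

end CubicGraphs

theorem corollary3p2 {V : Type*} [Fintype V] (G : SimpleGraph V) [DecidableRel G.Adj]
    (hconn : G.Connected) (hcubic : G.IsRegularOfDegree 3) (hbridgeless : G.Bridgeless)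
    (t : ℕ) (ht : 0 < t) :
    ∃ M : Fin t → G.Subgraph, (∀ i, (M i).IsPerfectMatching) ∧
      ¬ ∃ C : Set (Sym2 V), G.IsKCut (2 * t + 1) C ∧ C ⊆ ⋂ i, (M i).edgeSet := by
  have := hconn.nonempty
  have hA := SimpleGraph.isRGraph_adjWeight hcubic hbridgeless
  obtain ⟨w, m, hw, hm, hsum⟩ := hA.exists_matchingWeights t
  refine ⟨fun i => SimpleGraph.matchingSubgraph (hm i),
    fun i => SimpleGraph.isPerfectMatching_matchingSubgraph (hm i), ?_⟩
  rintro ⟨C, ⟨hCmin, hCcard⟩, hCM⟩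
  obtain ⟨Y, rfl⟩ := hCmin.exists_eq_edgeCut hconn
  rw [SimpleGraph.ncard_edgeCut] at hCcard
  have hY : Odd Y.ncard := by
    have h := cutWeight_modEq hA.symm hA.regular Y
    rw [hCcard] at h
    rw [Nat.odd_iff]
    unfold Nat.ModEq at h
    omega
  have h1 := hw.odd_cut Y hY
  -- All `t` matchings contain each cut edge, so at most `(t + 1) - t = 1` of its weight remains.
  have h2 : cutWeight w Y ≤ cutWeight G.adjWeight Y := by
    unfold cutWeight
    gcongr with u _ v _
    split_ifs with huv
    · have hs := hsum u v
      by_cases hadj : G.Adj u v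
      · have hmem := hCM (SimpleGraph.mk_mem_edgeCut huv.1 huv.2 hadj)
        have hge : t ≤ ∑ i, m i u v := by
          calc t = ∑ _i : Fin t, 1 := by simp
            _ ≤ _ := Finset.sum_le_sum fun i _ =>
              Nat.one_le_iff_ne_zero.2 (Set.mem_iInter.1 hmem i)
        have hone : G.adjWeight u v = 1 := if_pos hadj
        rw [hone] at hs ⊢
        omega
      · rw [show G.adjWeight u v = 0 from if_neg hadj] at hs
        omega
    · rfl
  omega
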